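/- Let $n\ge 1$ and let $x=(x_1,\dots,x_n)$ be independent random variables, each uniformly distributed on $\{1,\dots,n\}$. The algorithm LINEAR tests whether a sequence $s=(s_1,\dots,s_n)$ with entries in $\{1,\dots,n\}$ has pairwise different entries, as follows: it sets $g\leftarrow\text{True}$ and $v_i\leftarrow 0$ for $i=1,\dots,n$; then, for $i=1,\dots,n$ in this order, it tests whether $v_{s_i}>0$; if so, it sets $g\leftarrow\text{False}$ and returns $g$, otherwise it sets $v_{s_i}\leftarrow v_{s_i}+1$; if the loop ends without a return, it returns $g$. Its running time on $s$ is the number of executed assignments $\leftarrow$ displayed here plus the number of executed comparisons $v_{s_i}>0$ (the administration of the loop counters is not counted). For $n\ge 1$ put $$\kappa(n)=\frac13-\sqrt{\frac{\pi n}{2}}+\sum_{k=1}^{n}\frac{n!\,k^2}{(n-k)!\,n^{k+1}}.$$ Then for every $n\ge 1$ the expected running time $T_L$ of LINEAR on the input $x$ is $$T_L=n+\sqrt{2\pi n}+\frac73+2\kappa(n)-2\,\frac{n!}{n^n},$$ and $\kappa$ is strictly decreasing, $\kappa(n+1)<\kappa(n)$ for all $n\ge1$, with $\kappa(n)\to0$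 as $n\to\infty$. -/

import Mathlib

open MeasureTheory ProbabilityTheory
open scoped ENNReal Nat Topology

/-- The result of a computation together with the numbers of assignments and of comparisons
that were executed to obtain it. -/
structure Counted (α : Type) where
  /-- the value computed -/
  val : α
  /-- number of executed assignments -/
  assignments : ℕ
  /-- number of executed comparisons -/
  comparisons : ℕ

/-- Sequential composition adds up the costs; returning a value is free. -/
instance : Monad Counted where
  pure a := ⟨a, 0, 0⟩
  bind c f :=
    ⟨(f c.val).val, c.assignments + (f c.val).assignments,
      c.comparisons + (f c.val).comparisons⟩

namespace Counted

/-- One executed assignment: the new content of the variable that is written.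
(For one entry of a vector: the vector with that entry overwritten.) -/
def assign {α : Type} (a : α) : Counted α := ⟨a, 1, 0⟩

/-- One executed comparison: the test `0 < a`. -/
def testPos (a : ℕ) : Counted Bool := ⟨decide (0 < a), 0, 1⟩

/-- The running time: assignments plus comparisons. -/
def time {α : Type} (c : Counted α) : ℕ := c.assignments + c.comparisons

end Counted

open Counted in
/-- The algorithm LINEAR, run on the sequence `s` of length `n`. The type `Fin n` is used both for
the positions `1, …, n` and for the values `1, …, n`; `v₀` is the (arbitrary) content of the work
vector before the run. As usual for the counting of assignments and comparisons in pseudocode, the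
bookkeeping of the two `for` loops is not counted. -/
def linear (n : ℕ) (v₀ : Fin n → ℕ) (s : Fin n → Fin n) : Counted Bool := do
  let mut v := v₀
  let mut g ← assign true
  for i in List.finRange n do
    v ← assign (Function.update v i 0)
  for i in List.finRange n do
    if ← testPos (v (s i)) then
      g ← assign false
      return g
    else
      v ← assign (Function.update v (s i) (v (s i) + 1))
  return g

/-- `κ(n) = 1/3 - √(πn/2) + ∑_{k=1}^n n! k² / ((n-k)! n^(k+1))`, for `n ≥ 1`. -/
noncomputable def kappa (n : ℕ) : ℝ :=
  1 / 3 - √(Real.pi * n / 2)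
    + ∑ k ∈ Finset.Icc 1 n, ((n ! : ℝ) * (k : ℝ) ^ 2) / (((n - k)! : ℝ) * (n : ℝ) ^ (k + 1))

/-! Write p_k for `distinctProb n k` and w(y) for `expWeight y` = (1+y)e^{-y} = e^{-z²/2}, with z =
`lagrangeRoot y`. Pass i+1 of the main loop is reached iff the first i entries are distinct, and
each pass costs 2, so T_L = n + 1 + 2(p_0 + … + p_{n-1}). Abel summation turns the sum in κ into p_1
+ … + p_n, which gives the formula for T_L.

For κ itself, each of its three terms is an integral over (0, ∞): 1 = n∫ y/(1+y) wⁿ, ∑ p_k = n∫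
1/(1+y) wⁿ, and √(πn/2) = n∫ z′ wⁿ with z′ = y/((1+y)z). Since (wⁿ)′ = -n y/(1+y) wⁿ, these combine
to κ(n) = -∫ h (wⁿ)′ with h = 1/3 + 1/y - 1/z, and integration by parts gives κ(n) = ∫ h′ wⁿ
(`kappa_eq_integral`). As h′ > 0 is integrable and 0 < w < 1, κ decreases strictly and tends to 0 by
dominated convergence. -/

section

/-! ### Analysis of z and of h = 1/3 + 1/y - 1/z. -/

open Set Filter

/-- The function `z` with `z ^ 2 / 2 = y - log (1 + y)`. -/
noncomputable def lagrangeRoot (y : ℝ) : ℝ := √(2 * (y - Real.log (1 + y)))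

theorem hasDerivAt_sub_log_one_add {y : ℝ} (hy : 0 ≤ y) :
    HasDerivAt (fun y : ℝ => y - Real.log (1 + y)) (y / (1 + y)) y := by
  have h : (1 + y) ≠ 0 := by positivity
  have h1 : HasDerivAt (fun y : ℝ => 1 + y) 1 y := (hasDerivAt_id y).const_add 1
  have := (hasDerivAt_id y).sub (h1.log h)
  refine this.congr_deriv ?_
  field_simp
  ring

theorem log_one_add_lt_self {y : ℝ} (hy : 0 < y) : Real.log (1 + y) < y := by
  have := Real.log_lt_sub_one_of_pos (x := 1 + y) (by positivity) (by linarith)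
  linarith

theorem lagrangeRoot_zero : lagrangeRoot 0 = 0 := by simp [lagrangeRoot]

theorem lagrangeRoot_pos {y : ℝ} (hy : 0 < y) : 0 < lagrangeRoot y := by
  have := log_one_add_lt_self hy
  exact Real.sqrt_pos.2 (by linarith)

theorem lagrangeRoot_sq {y : ℝ} (hy : 0 < y) :
    lagrangeRoot y ^ 2 = 2 * (y - Real.log (1 + y)) := by
  have := log_one_add_lt_self hy
  exact Real.sq_sqrt (by linarith)

theorem hasDerivAt_lagrangeRoot {y : ℝ} (hy : 0 < y) :
    HasDerivAt lagrangeRoot (y / ((1 + y) * lagrangeRoot y)) y := by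
  have h0 := log_one_add_lt_self hy
  have h1 : HasDerivAt (fun y : ℝ => 2 * (y - Real.log (1 + y))) (2 * (y / (1 + y))) y :=
    (hasDerivAt_sub_log_one_add hy.le).const_mul 2
  have h2 := h1.sqrt (by linarith)
  refine h2.congr_deriv ?_
  have := lagrangeRoot_pos hy
  change _ / (2 * lagrangeRoot y) = _
  field_simp

theorem continuousOn_lagrangeRoot : ContinuousOn lagrangeRoot (Ici 0) := by
  unfold lagrangeRoot
  refine ContinuousOn.sqrt (ContinuousOn.mul continuousOn_const
    (ContinuousOn.sub continuousOn_id (ContinuousOn.log (by fun_prop) ?_)))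
  intro x hx
  have : (0 : ℝ) ≤ x := hx
  positivity

theorem strictMonoOn_lagrangeRoot : StrictMonoOn lagrangeRoot (Ici 0) := by
  refine strictMonoOn_of_deriv_pos (convex_Ici 0) continuousOn_lagrangeRoot ?_
  intro y hy
  rw [interior_Ici] at hy
  have hy : 0 < y := hy
  have := lagrangeRoot_pos hy
  rw [(hasDerivAt_lagrangeRoot hy).deriv]
  positivity

theorem pos_of_hasDerivAt_pos {f f' : ℝ → ℝ} {a : ℝ} (ha : f a = 0)
    (hd : ∀ x, a ≤ x → HasDerivAt f (f' x) x) (hp : ∀ x, a < x → 0 < f' x) {x : ℝ} (hx : a < x) :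
    0 < f x := by
  have : StrictMonoOn f (Ici a) := by
    refine strictMonoOn_of_deriv_pos (convex_Ici a)
      (fun x hx => (hd x hx).continuousAt.continuousWithinAt) ?_
    intro y hy
    rw [interior_Ici] at hy
    rw [(hd y (le_of_lt hy)).deriv]
    exact hp y hy
  rw [← ha]
  exact this self_mem_Ici hx.le hx

/-- This is y²/t² > z² after the substitution 1 + y = t³, which removes the cube root; the
derivative then factors with a visible sign. -/
theorem sq_div_sq_sub_log_pos {t : ℝ} (ht : 1 < t) :
    0 < (t ^ 3 - 1) ^ 2 / t ^ 2 - 2 * (t ^ 3 - 1) + 6 * Real.log t := by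
  refine pos_of_hasDerivAt_pos
    (f := fun t : ℝ => (t ^ 3 - 1) ^ 2 / t ^ 2 - 2 * (t ^ 3 - 1) + 6 * Real.log t)
    (f' := fun t : ℝ => 2 * (t ^ 3 - 1) * ((t - 1) ^ 2 * (2 * t + 1)) / t ^ 3)
    (a := 1) (by simp) ?_ ?_ ht
  · intro x hx
    have hx0 : x ≠ 0 := by positivity
    have h3 : HasDerivAt (fun t : ℝ => t ^ 3 - 1) (3 * x ^ 2) x := by
      simpa using (hasDerivAt_pow 3 x).sub_const 1
    have h := (((h3.pow 2).div (hasDerivAt_pow 2 x) (by positivity)).sub (h3.const_mul 2)).add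
      ((Real.hasDerivAt_log hx0).const_mul 6)
    refine h.congr_deriv ?_
    simp only [Pi.pow_apply]
    field_simp
    ring
  · intro x hx
    have h1 : 0 < x - 1 := by linarith
    have h0 : 0 < x := by linarith
    have h3 : 0 < x ^ 3 - 1 := by
      have : x ^ 3 - 1 = (x - 1) * (x ^ 2 + x + 1) := by ring
      rw [this]; positivity
    positivity

theorem lagrangeRoot_mul_cbrt_lt {y t : ℝ} (ht : 1 < t) (hty : t ^ 3 = 1 + y) :
    lagrangeRoot y * t < y := by
  have h0 : 0 < t := by linarith
  have hy : 0 < y := by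
    have : y = (t - 1) * (t ^ 2 + t + 1) := by linear_combination - hty
    have : 0 < t - 1 := by linarith
    rw [‹y = _›]; positivity
  have h := sq_div_sq_sub_log_pos ht
  have hl : Real.log (1 + y) = 3 * Real.log t := by rw [← hty, Real.log_pow]; norm_num
  have hyt : t ^ 3 - 1 = y := by linarith
  refine lt_of_pow_lt_pow_left₀ 2 hy.le ?_
  rw [mul_pow, lagrangeRoot_sq hy, hl]
  rw [hyt] at h
  rw [← lt_div_iff₀ (by positivity)]
  linarith

theorem exists_cbrt_one_add {y : ℝ} (hy : 0 < y) : ∃ t : ℝ, 1 < t ∧ t ^ 3 = 1 + y := by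
  refine ⟨(1 + y) ^ ((3 : ℕ) : ℝ)⁻¹, Real.one_lt_rpow (by linarith) (by norm_num),
    Real.rpow_inv_natCast_pow (by positivity) (by norm_num)⟩

/-- Exactly the inequality that makes h′ positive. -/
theorem lagrangeRoot_cube_lt {y : ℝ} (hy : 0 < y) : (1 + y) * lagrangeRoot y ^ 3 < y ^ 3 := by
  obtain ⟨t, ht, hty⟩ := exists_cbrt_one_add hy
  have h := lagrangeRoot_mul_cbrt_lt ht hty
  have := lagrangeRoot_pos hy
  have := pow_lt_pow_left₀ h (by positivity) (n := 3) (by norm_num)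
  rw [mul_pow, hty] at this
  linarith

/-- The left side is the reciprocal of 1/3 + 1/y, so this says h ≥ 0. -/
theorem le_lagrangeRoot {y : ℝ} (hy : 0 < y) : 3 * y / (y + 3) ≤ lagrangeRoot y := by
  have h : 0 < 2 * (y - Real.log (1 + y)) - 9 * y ^ 2 / (y + 3) ^ 2 := by
    refine pos_of_hasDerivAt_pos
      (f := fun y : ℝ => 2 * (y - Real.log (1 + y)) - 9 * y ^ 2 / (y + 3) ^ 2)
      (f' := fun y : ℝ => 2 * y ^ 3 * (y + 9) / ((1 + y) * (y + 3) ^ 3)) (a := 0) (by simp) ?_ ?_ hy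
    · intro x hx
      have h1 := (hasDerivAt_sub_log_one_add hx).const_mul 2
      have h2 : HasDerivAt (fun y : ℝ => 9 * y ^ 2) (9 * (2 * x)) x := by
        simpa using (hasDerivAt_pow 2 x).const_mul 9
      have h3 : HasDerivAt (fun y : ℝ => (y + 3) ^ 2) (2 * (x + 3)) x := by
        simpa using ((hasDerivAt_id x).add_const 3).fun_pow 2
      refine (h1.sub (h2.div h3 (by positivity))).congr_deriv ?_
      have : 1 + x ≠ 0 := by positivity
      have : x + 3 ≠ 0 := by positivity
      field_simp
      ring
    · intro x hx
      positivity
  refine le_of_lt (lt_of_pow_lt_pow_left₀ 2 (lagrangeRoot_pos hy).le ?_)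
  rw [lagrangeRoot_sq hy, div_pow, mul_pow]
  norm_num
  linarith

theorem tendsto_lagrangeRoot_atTop : Tendsto lagrangeRoot atTop atTop := by
  unfold lagrangeRoot
  refine Real.tendsto_sqrt_atTop.comp ?_
  refine tendsto_atTop_mono' atTop (f₁ := fun y : ℝ => y - 2) ?_
    (tendsto_atTop_add_const_right _ _ tendsto_id)
  filter_upwards [eventually_gt_atTop 0] with y hy
  -- The tangent of log at 2 has slope 1/2, so y - log (1 + y) keeps linear growth; the tangent at 1
  -- would leave nothing.
  have h := Real.log_lt_sub_one_of_pos (x := (1 + y) / 2) (by positivity)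
  by_cases h1 : (1 + y) / 2 = 1
  · have : y = 1 := by linarith
    subst this
    have := log_one_add_lt_self hy
    linarith
  · have h2 := h h1
    rw [Real.log_div (by positivity) (by norm_num)] at h2
    have := Real.log_two_lt_d9
    linarith

/-- The function `1 / 3 + 1 / y - 1 / z` with `z ^ 2 / 2 = y - log (1 + y)`, extended by its
limit `0` at `0`. -/
noncomputable def reciprocalGap (y : ℝ) : ℝ :=
  if y = 0 then 0 else 1 / 3 + 1 / y - 1 / lagrangeRoot y

/-- The derivative of `reciprocalGap`. -/
noncomputable def reciprocalGapDeriv (y : ℝ) : ℝ :=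
  y / ((1 + y) * lagrangeRoot y ^ 3) - 1 / y ^ 2

theorem reciprocalGap_of_pos {y : ℝ} (hy : 0 < y) :
    reciprocalGap y = 1 / 3 + 1 / y - 1 / lagrangeRoot y := if_neg hy.ne'

theorem hasDerivAt_reciprocalGap {y : ℝ} (hy : 0 < y) :
    HasDerivAt reciprocalGap (reciprocalGapDeriv y) y := by
  have hz := lagrangeRoot_pos hy
  have h := ((hasDerivAt_inv hy.ne').const_add (1 / 3)).sub
    ((hasDerivAt_lagrangeRoot hy).fun_inv hz.ne')
  refine (h.congr_deriv ?_).congr_of_eventuallyEq ?_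
  · unfold reciprocalGapDeriv
    field_simp
    ring
  · filter_upwards [lt_mem_nhds hy] with x hx
    simp [reciprocalGap_of_pos hx]

theorem reciprocalGapDeriv_pos {y : ℝ} (hy : 0 < y) : 0 < reciprocalGapDeriv y := by
  have hz := lagrangeRoot_pos hy
  have h := lagrangeRoot_cube_lt hy
  rw [reciprocalGapDeriv, sub_pos, div_lt_div_iff₀ (by positivity) (by positivity)]
  linarith

theorem reciprocalGap_nonneg {y : ℝ} (hy : 0 ≤ y) : 0 ≤ reciprocalGap y := by
  rcases hy.eq_or_lt with rfl | hy
  · simp [reciprocalGap]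
  have hz := lagrangeRoot_pos hy
  have h := le_lagrangeRoot hy
  have h1 := one_div_le_one_div_of_le (by positivity) h
  have h2 : 1 / (3 * y / (y + 3)) = 1 / 3 + 1 / y := by field_simp
  rw [reciprocalGap_of_pos hy]
  linarith

theorem reciprocalGap_le_of_cbrt {y t : ℝ} (ht : 1 < t) (hty : t ^ 3 = 1 + y) :
    reciprocalGap y ≤ 1 / 3 - 1 / (t ^ 2 + t + 1) := by
  have hyt : y = (t - 1) * (t ^ 2 + t + 1) := by linear_combination - hty
  have h0 : 0 < t := by linarith
  have h1 : 0 < t - 1 := by linarith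
  have hy : 0 < y := by rw [hyt]; positivity
  have hz := lagrangeRoot_pos hy
  have h := lagrangeRoot_mul_cbrt_lt ht hty
  have h2 : t / y ≤ 1 / lagrangeRoot y := by
    rw [div_le_div_iff₀ hy hz]; linarith
  have h3 : t / y - 1 / y = 1 / (t ^ 2 + t + 1) := by
    rw [hyt]; field_simp
  rw [reciprocalGap_of_pos hy]
  linarith

/-- Squeeze between 0 and 1/3 - 1/(t² + t + 1), where t is the cube root of 1 + y and tends to 1; no
expansion of z is needed. -/
theorem continuousWithinAt_reciprocalGap : ContinuousWithinAt reciprocalGap (Ici 0) 0 := by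
  have h0 : reciprocalGap 0 = 0 := if_pos rfl
  rw [ContinuousWithinAt, h0]
  have hc : Continuous (fun y : ℝ => (1 + y) ^ ((3 : ℕ) : ℝ)⁻¹) :=
    (continuous_const.add continuous_id).rpow_const (fun _ => Or.inr (by norm_num))
  have ht : Tendsto (fun y : ℝ => (1 + y) ^ ((3 : ℕ) : ℝ)⁻¹) (𝓝[Ici 0] 0) (𝓝 1) := by
    have := hc.tendsto 0
    simp only [add_zero, Real.one_rpow] at this
    exact this.mono_left nhdsWithin_le_nhds
  have hlim : Tendsto (fun y : ℝ => 1 / 3 - 1 / (((1 + y) ^ ((3 : ℕ) : ℝ)⁻¹) ^ 2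
      + (1 + y) ^ ((3 : ℕ) : ℝ)⁻¹ + 1)) (𝓝[Ici 0] 0) (𝓝 0) := by
    have := (tendsto_const_nhds (x := (1 : ℝ) / 3)).sub ((tendsto_const_nhds (x := (1 : ℝ))).div
      (((ht.pow 2).add ht).add_const 1) (by norm_num))
    norm_num at this
    simpa using this
  refine tendsto_of_tendsto_of_tendsto_of_le_of_le' tendsto_const_nhds hlim ?_ ?_
  · filter_upwards [self_mem_nhdsWithin] with y hy using reciprocalGap_nonneg hy
  · filter_upwards [self_mem_nhdsWithin] with y hy
    rcases (show (0 : ℝ) ≤ y from hy).eq_or_lt with rfl | hy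
    · norm_num [reciprocalGap]
    · exact reciprocalGap_le_of_cbrt (Real.one_lt_rpow (by linarith) (by norm_num))
        (Real.rpow_inv_natCast_pow (by positivity) (by norm_num))

theorem tendsto_reciprocalGap_atTop : Tendsto reciprocalGap atTop (𝓝 (1 / 3)) := by
  have h := ((tendsto_const_nhds (x := (1 : ℝ) / 3)).add tendsto_inv_atTop_zero).sub
    tendsto_lagrangeRoot_atTop.inv_tendsto_atTop
  rw [add_zero, sub_zero] at h
  refine h.congr' ?_
  filter_upwards [eventually_gt_atTop 0] with y hy
  simp [reciprocalGap_of_pos hy]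

/-- A nonnegative derivative is integrable when its primitive has finite limits at both ends, here 0
and 1/3. -/
theorem integrableOn_reciprocalGapDeriv : IntegrableOn reciprocalGapDeriv (Ioi 0) :=
  integrableOn_Ioi_deriv_of_nonneg continuousWithinAt_reciprocalGap
    (fun _ hy => hasDerivAt_reciprocalGap hy) (fun _ hy => (reciprocalGapDeriv_pos hy).le)
    tendsto_reciprocalGap_atTop

end

/-! ### Integral representation of κ, monotonicity and limit. -/

section

open Set Filter

/-- The probability that `k` independent uniform samples from `n` values are pairwise different. -/
noncomputable def distinctProb (n k : ℕ) : ℝ := (n.descFactorial k : ℝ) / (n : ℝ) ^ k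

theorem distinctProb_zero (n : ℕ) : distinctProb n 0 = 1 := by simp [distinctProb]

theorem distinctProb_succ {n : ℕ} (hn : n ≠ 0) (k : ℕ) :
    distinctProb n (k + 1) = (1 - (k : ℝ) / n) * distinctProb n k := by
  have : (n : ℝ) ≠ 0 := by exact_mod_cast hn
  unfold distinctProb
  rcases le_or_gt k n with h | h
  · rw [Nat.descFactorial_succ]
    push_cast [h]
    field_simp
    ring
  · rw [Nat.descFactorial_of_lt h, Nat.descFactorial_of_lt (by omega)]
    simp

theorem distinctProb_succ_self (n : ℕ) : distinctProb n (n + 1) = 0 := by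
  simp [distinctProb]

theorem distinctProb_self (n : ℕ) : distinctProb n n = (n ! : ℝ) / (n : ℝ) ^ n := by
  simp [distinctProb, Nat.descFactorial_self]

/-- Abel summation: (k/n) p_k = p_k - p_{k+1}, multiplied by k. The boundary term vanishes at m = n
because p_{n+1} = 0. -/
theorem sum_sq_mul_distinctProb {n : ℕ} (hn : n ≠ 0) (m : ℕ) :
    ∑ k ∈ Finset.range m, ((k + 1 : ℕ) : ℝ) ^ 2 / n * distinctProb n (k + 1)
      = ∑ k ∈ Finset.range m, distinctProb n (k + 1) - m * distinctProb n (m + 1) := by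
  have : (n : ℝ) ≠ 0 := by exact_mod_cast hn
  induction m with
  | zero => simp
  | succ m ih =>
    rw [Finset.sum_range_succ, Finset.sum_range_succ, ih, distinctProb_succ hn (m + 1)]
    push_cast
    field_simp
    ring

theorem kappa_eq_sum_distinctProb {n : ℕ} (hn : n ≠ 0) :
    kappa n = 1 / 3 - √(Real.pi * n / 2) + ∑ k ∈ Finset.range n, distinctProb n (k + 1) := by
  have hn' : (n : ℝ) ≠ 0 := by exact_mod_cast hn
  have h := sum_sq_mul_distinctProb hn n
  rw [distinctProb_succ_self, mul_zero, sub_zero] at h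
  rw [kappa, ← h, ← Finset.Ico_add_one_right_eq_Icc, Finset.sum_Ico_eq_sum_range]
  congr 1
  refine Finset.sum_congr (by simp) fun k hk => ?_
  have hk : 1 + k ≤ n := by simp at hk; omega
  rw [add_comm 1 k] at hk ⊢
  rw [distinctProb, ← Nat.factorial_mul_descFactorial hk]
  have : ((n - (k + 1))! : ℝ) ≠ 0 := by positivity
  push_cast
  field_simp
  ring

theorem integral_pow_mul_exp_neg_mul (n : ℕ) (hn : n ≠ 0) (j : ℕ) :
    IntegrableOn (fun y : ℝ => y ^ j * Real.exp (-(n * y))) (Ioi 0) ∧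
    ∫ y : ℝ in Ioi 0, y ^ j * Real.exp (-(n * y)) = (j ! : ℝ) / (n : ℝ) ^ (j + 1) := by
  have hn' : 0 < (n : ℝ) := by positivity
  have h := Real.integral_rpow_mul_exp_neg_mul_Ioi (a := (j : ℝ) + 1) (r := n) (by positivity) hn'
  have e : ∀ y : ℝ, y ^ ((j : ℝ) + 1 - 1) * Real.exp (-(n * y)) = y ^ j * Real.exp (-(n * y)) := by
    intro y
    rw [add_sub_cancel_right, Real.rpow_natCast]
  simp only [e] at h
  rw [Real.Gamma_nat_eq_factorial] at h
  have h2 : ∫ y : ℝ in Ioi 0, y ^ j * Real.exp (-(n * y)) = (j ! : ℝ) / (n : ℝ) ^ (j + 1) := by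
    rw [h, ← Nat.cast_add_one, Real.rpow_natCast, one_div, inv_pow]
    field_simp
  refine ⟨?_, h2⟩
  -- A non-integrable function has integral 0 by convention, so a nonzero value proves
  -- integrability.
  refine not_imp_comm.1 integral_undef ?_
  rw [h2]
  positivity

/-- The function `(1 + y) * exp (-y)`, which is `exp (-z ^ 2 / 2)` for `z = lagrangeRoot y`. -/
noncomputable def expWeight (y : ℝ) : ℝ := (1 + y) * Real.exp (-y)

theorem continuous_expWeight : Continuous expWeight := by unfold expWeight; fun_prop

theorem expWeight_pos {y : ℝ} (hy : 0 ≤ y) : 0 < expWeight y := by unfold expWeight; positivity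

theorem expWeight_lt_one {y : ℝ} (hy : 0 < y) : expWeight y < 1 := by
  have := Real.add_one_lt_exp hy.ne'
  rw [expWeight, Real.exp_neg, ← div_eq_mul_inv, div_lt_one (Real.exp_pos y)]
  linarith

theorem expWeight_pow (n : ℕ) (y : ℝ) :
    expWeight y ^ n = (1 + y) ^ n * Real.exp (-(n * y)) := by
  rw [expWeight, mul_pow, ← Real.exp_nat_mul]
  ring_nf

theorem tendsto_expWeight_pow_atTop {n : ℕ} (hn : n ≠ 0) :
    Tendsto (fun y => expWeight y ^ n) atTop (𝓝 0) := by
  have h : Tendsto expWeight atTop (𝓝 0) := by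
    have h0 := Real.tendsto_pow_mul_exp_neg_atTop_nhds_zero 0
    have h1 := Real.tendsto_pow_mul_exp_neg_atTop_nhds_zero 1
    have := h0.add h1
    rw [add_zero] at this
    refine this.congr fun y => ?_
    rw [expWeight]; ring
  simpa [hn] using h.pow n

theorem hasDerivAt_expWeight_pow (n : ℕ) {y : ℝ} (hy : 0 ≤ y) :
    HasDerivAt (fun y => expWeight y ^ n) (-(n * (y / (1 + y)) * expWeight y ^ n)) y := by
  have h1 : HasDerivAt expWeight (-(y * Real.exp (-y))) y := by
    have := ((hasDerivAt_id y).const_add 1).mul ((hasDerivAt_id y).neg.exp)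
    refine this.congr_deriv ?_
    simp only [Pi.neg_apply, id]
    ring
  refine (h1.fun_pow n).congr_deriv ?_
  rcases n with _ | n
  · simp
  · rw [Nat.add_sub_cancel, pow_succ (expWeight y)]
    nth_rewrite 3 [expWeight]
    field_simp

theorem expWeight_pow_eq_exp (n : ℕ) {y : ℝ} (hy : 0 < y) :
    expWeight y ^ n = Real.exp (-(n / 2 : ℝ) * lagrangeRoot y ^ 2) := by
  rw [lagrangeRoot_sq hy, expWeight_pow, ← Real.exp_log (show (0 : ℝ) < (1 + y) ^ n by positivity),
    ← Real.exp_add, Real.log_pow]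
  ring_nf

/-- The factor 1/(1+y) lowers the power to (1+y)^{n-1}; the j-th term of its binomial expansion is a
Gamma integral equal to p_{j+1}. -/
theorem integral_inv_one_add_mul_expWeight_pow {n : ℕ} (hn : n ≠ 0) :
    IntegrableOn (fun y => n * (1 / (1 + y)) * expWeight y ^ n) (Ioi 0) ∧
    ∫ y in Ioi 0, n * (1 / (1 + y)) * expWeight y ^ n
      = ∑ k ∈ Finset.range n, distinctProb n (k + 1) := by
  have hn' : (n : ℝ) ≠ 0 := by exact_mod_cast hn
  obtain ⟨m, rfl⟩ := Nat.exists_eq_succ_of_ne_zero hn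
  have e : EqOn (fun y : ℝ => ((m + 1 : ℕ) : ℝ) * (1 / (1 + y)) * expWeight y ^ (m + 1))
      (fun y => ∑ j ∈ Finset.range (m + 1), ((m + 1 : ℕ) : ℝ) * (m.choose j : ℝ) *
        (y ^ j * Real.exp (-((m + 1 : ℕ) * y)))) (Ioi 0) := by
    intro y hy
    have hy : 0 < y := hy
    have h2 : (1 + y) ^ m = ∑ j ∈ Finset.range (m + 1), y ^ j * (m.choose j : ℝ) := by
      rw [add_comm, add_pow]; simp
    simp only
    rw [expWeight_pow, pow_succ (1 + y), h2]
    field_simp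
    simp only [Finset.sum_mul, Finset.mul_sum]
    exact Finset.sum_congr rfl fun _ _ => by ring
  have hi : ∀ j ∈ Finset.range (m + 1), IntegrableOn (fun y : ℝ => ((m + 1 : ℕ) : ℝ) *
      (m.choose j : ℝ) * (y ^ j * Real.exp (-((m + 1 : ℕ) * y)))) (Ioi 0) :=
    fun j _ => (integral_pow_mul_exp_neg_mul (m + 1) hn j).1.const_mul _
  refine ⟨IntegrableOn.congr_fun (integrable_finsetSum _ hi) e.symm measurableSet_Ioi, ?_⟩
  rw [setIntegral_congr_fun measurableSet_Ioi e, integral_finsetSum _ hi]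
  refine Finset.sum_congr rfl fun j _ => ?_
  rw [integral_const_mul, (integral_pow_mul_exp_neg_mul (m + 1) hn j).2, distinctProb,
    Nat.succ_descFactorial_succ, Nat.descFactorial_eq_factorial_mul_choose]
  push_cast at hn' ⊢
  field_simp

theorem integral_div_one_add_mul_expWeight_pow {n : ℕ} (hn : n ≠ 0) :
    IntegrableOn (fun y => n * (y / (1 + y)) * expWeight y ^ n) (Ioi 0) ∧
    ∫ y in Ioi 0, n * (y / (1 + y)) * expWeight y ^ n = 1 := by
  have hd : ∀ y ∈ Ioi (0 : ℝ), HasDerivAt (fun y => -expWeight y ^ n)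
      (n * (y / (1 + y)) * expWeight y ^ n) y := fun y hy =>
    (hasDerivAt_expWeight_pow n (le_of_lt hy)).fun_neg.congr_deriv (neg_neg _)
  have hc : ContinuousWithinAt (fun y => -expWeight y ^ n) (Ici 0) 0 :=
    (continuous_expWeight.pow n).neg.continuousWithinAt
  have ht : Tendsto (fun y => -expWeight y ^ n) atTop (𝓝 0) := by
    simpa using (tendsto_expWeight_pow_atTop hn).neg
  have hp : ∀ y ∈ Ioi (0 : ℝ), 0 ≤ n * (y / (1 + y)) * expWeight y ^ n := by
    intro y hy
    have hy : 0 < y := hy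
    have := expWeight_pos hy.le
    positivity
  refine ⟨integrableOn_Ioi_deriv_of_nonneg hc hd hp ht, ?_⟩
  rw [integral_Ioi_of_hasDerivAt_of_nonneg hc hd hp ht]
  simp [expWeight]

theorem lagrangeRoot_image_Ioi : lagrangeRoot '' Ioi 0 = Ioi 0 := by
  apply Subset.antisymm
  · rintro _ ⟨y, hy, rfl⟩
    exact lagrangeRoot_pos hy
  · intro z hz
    obtain ⟨b, hb⟩ := (tendsto_lagrangeRoot_atTop.eventually_ge_atTop z).and
      (eventually_ge_atTop 0) |>.exists
    obtain ⟨y, hy, rfl⟩ := intermediate_value_Icc hb.2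
      (continuousOn_lagrangeRoot.mono Icc_subset_Ici_self)
      ⟨lagrangeRoot_zero.trans_le (le_of_lt hz), hb.1⟩
    refine ⟨y, lt_of_le_of_ne hy.1 ?_, rfl⟩
    rintro rfl
    rw [lagrangeRoot_zero] at hz
    exact lt_irrefl (0 : ℝ) hz

/-- The change of variables z = `lagrangeRoot y` gives half a Gaussian integral. -/
theorem integral_deriv_lagrangeRoot_mul_expWeight_pow {n : ℕ} (hn : n ≠ 0) :
    IntegrableOn (fun y => y / ((1 + y) * lagrangeRoot y) * expWeight y ^ n) (Ioi 0) ∧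
    ∫ y in Ioi 0, y / ((1 + y) * lagrangeRoot y) * expWeight y ^ n
      = √(Real.pi / (n / 2 : ℝ)) / 2 := by
  have hn' : 0 < (n / 2 : ℝ) := by positivity
  have hd : ∀ y ∈ Ioi (0 : ℝ), HasDerivWithinAt lagrangeRoot
      (y / ((1 + y) * lagrangeRoot y)) (Ioi 0) y :=
    fun y hy => (hasDerivAt_lagrangeRoot hy).hasDerivWithinAt
  have hinj : InjOn lagrangeRoot (Ioi 0) :=
    strictMonoOn_lagrangeRoot.injOn.mono Ioi_subset_Ici_self
  have e : EqOn (fun y => |y / ((1 + y) * lagrangeRoot y)| •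
        Real.exp (-(n / 2 : ℝ) * lagrangeRoot y ^ 2))
      (fun y => y / ((1 + y) * lagrangeRoot y) * expWeight y ^ n) (Ioi 0) := by
    intro y hy
    have hy : 0 < y := hy
    have := lagrangeRoot_pos hy
    simp only [smul_eq_mul]
    rw [expWeight_pow_eq_exp n hy, abs_of_pos (by positivity)]
  have hI := integrableOn_image_iff_integrableOn_abs_deriv_smul measurableSet_Ioi hd hinj
    (fun z : ℝ => Real.exp (-(n / 2 : ℝ) * z ^ 2))
  have hE := integral_image_eq_integral_abs_deriv_smul measurableSet_Ioi hd hinj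
    (fun z : ℝ => Real.exp (-(n / 2 : ℝ) * z ^ 2))
  rw [lagrangeRoot_image_Ioi] at hI hE
  refine ⟨(hI.1 (integrable_exp_neg_mul_sq hn').integrableOn).congr_fun e measurableSet_Ioi, ?_⟩
  rw [← setIntegral_congr_fun measurableSet_Ioi e, ← hE, integral_gaussian_Ioi]

theorem integrableOn_reciprocalGapDeriv_mul (n : ℕ) :
    IntegrableOn (fun y => reciprocalGapDeriv y * expWeight y ^ n) (Ioi 0) := by
  refine Integrable.mul_bdd (c := 1) integrableOn_reciprocalGapDeriv
    (continuous_expWeight.pow n).aestronglyMeasurable ?_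
  filter_upwards [ae_restrict_mem measurableSet_Ioi] with y hy
  have := expWeight_pos (le_of_lt hy)
  rw [Real.norm_of_nonneg (by positivity)]
  exact pow_le_one₀ this.le (expWeight_lt_one hy).le

theorem kappa_eq_integral {n : ℕ} (hn : n ≠ 0) :
    kappa n = ∫ y in Ioi 0, reciprocalGapDeriv y * expWeight y ^ n := by
  obtain ⟨iA, hA⟩ := integral_inv_one_add_mul_expWeight_pow hn
  obtain ⟨iB, hB⟩ := integral_div_one_add_mul_expWeight_pow hn
  obtain ⟨iC, hC⟩ := integral_deriv_lagrangeRoot_mul_expWeight_pow hn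
  have iD := integrableOn_reciprocalGapDeriv_mul n
  -- The product rule, with h (wⁿ)′ split along 1/3, 1/y and -1/z. The boundary terms vanish: h(0) =
  -- 0, and wⁿ → 0 at infinity.
  have hd : ∀ y ∈ Ioi (0 : ℝ), HasDerivAt (fun y => reciprocalGap y * expWeight y ^ n)
      (reciprocalGapDeriv y * expWeight y ^ n - (1 / 3 * (n * (y / (1 + y)) * expWeight y ^ n)
        + n * (1 / (1 + y)) * expWeight y ^ n
        - n * (y / ((1 + y) * lagrangeRoot y) * expWeight y ^ n))) y := by
    intro y hy
    have hy : 0 < y := hy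
    have hz := lagrangeRoot_pos hy
    refine ((hasDerivAt_reciprocalGap hy).mul (hasDerivAt_expWeight_pow n hy.le)).congr_deriv ?_
    rw [reciprocalGap_of_pos hy]
    field_simp
    ring
  have i1 := (iB.const_mul (1 / 3)).fun_add iA
  have i2 := Integrable.sub' i1 (iC.const_mul (n : ℝ))
  have hc : ContinuousWithinAt (fun y => reciprocalGap y * expWeight y ^ n) (Ici 0) 0 :=
    continuousWithinAt_reciprocalGap.mul (continuous_expWeight.pow n).continuousWithinAt
  have ht : Tendsto (fun y => reciprocalGap y * expWeight y ^ n) atTop (𝓝 0) := by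
    simpa using tendsto_reciprocalGap_atTop.mul (tendsto_expWeight_pow_atTop hn)
  have h := integral_Ioi_of_hasDerivAt_of_tendsto hc hd (Integrable.sub' iD i2) ht
  have h1 : reciprocalGap 0 = 0 := if_pos rfl
  rw [integral_sub iD i2, integral_sub i1 (iC.const_mul (n : ℝ)),
    integral_add (iB.const_mul (1 / 3)) iA, integral_const_mul, integral_const_mul,
    hA, hB, hC, h1] at h
  have hs : (n : ℝ) * (√(Real.pi / (n / 2 : ℝ)) / 2) = √(Real.pi * n / 2) := by
    have hn' : 0 < (n : ℝ) := by positivity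
    rw [eq_comm, Real.sqrt_eq_iff_mul_self_eq (by positivity) (by positivity)]
    have := Real.mul_self_sqrt (show 0 ≤ Real.pi / (n / 2 : ℝ) by positivity)
    symm
    calc (n : ℝ) * (√(Real.pi / (n / 2 : ℝ)) / 2) * (n * (√(Real.pi / (n / 2 : ℝ)) / 2))
        = n ^ 2 / 4 * (√(Real.pi / (n / 2 : ℝ)) * √(Real.pi / (n / 2 : ℝ))) := by ring
      _ = Real.pi * n / 2 := by rw [this]; field_simp; norm_num
  rw [hs] at h
  rw [kappa_eq_sum_distinctProb hn]
  linarith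

theorem strictAntiOn_kappa : StrictAntiOn kappa (Ici 1) := by
  intro m hm n hn hmn
  have hm : 1 ≤ m := hm
  rw [kappa_eq_integral (by omega), kappa_eq_integral (by omega), ← sub_pos,
    ← integral_sub (integrableOn_reciprocalGapDeriv_mul m) (integrableOn_reciprocalGapDeriv_mul n)]
  have hp : ∀ y ∈ Ioi (0 : ℝ), 0 < reciprocalGapDeriv y * expWeight y ^ m
      - reciprocalGapDeriv y * expWeight y ^ n := by
    intro y hy
    have hy : 0 < y := hy
    rw [← mul_sub]
    exact mul_pos (reciprocalGapDeriv_pos hy) (sub_pos.2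
      (pow_lt_pow_right_of_lt_one₀ (expWeight_pos hy.le) (expWeight_lt_one hy) hmn))
  rw [setIntegral_pos_iff_support_of_nonneg_ae]
  · have : Ioi (0 : ℝ) ⊆ Function.support (fun y => reciprocalGapDeriv y * expWeight y ^ m
      - reciprocalGapDeriv y * expWeight y ^ n) ∩ Ioi 0 := fun y hy => ⟨(hp y hy).ne', hy⟩
    refine lt_of_lt_of_le ?_ (measure_mono this)
    simp
  · filter_upwards [ae_restrict_mem measurableSet_Ioi] with y hy using (hp y hy).le
  · exact (integrableOn_reciprocalGapDeriv_mul m).sub (integrableOn_reciprocalGapDeriv_mul n)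

theorem tendsto_kappa : Tendsto kappa atTop (𝓝 0) := by
  have h : Tendsto (fun n : ℕ => ∫ y in Ioi 0, reciprocalGapDeriv y * expWeight y ^ n) atTop
      (𝓝 (∫ y in Ioi (0 : ℝ), (0 : ℝ))) := by
    refine tendsto_integral_of_dominated_convergence reciprocalGapDeriv
      (fun n => (integrableOn_reciprocalGapDeriv_mul n).aestronglyMeasurable)
      integrableOn_reciprocalGapDeriv (fun n => ?_) ?_
    · filter_upwards [ae_restrict_mem measurableSet_Ioi] with y hy
      have h1 := expWeight_pos (le_of_lt hy)
      have h2 := reciprocalGapDeriv_pos hy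
      rw [Real.norm_of_nonneg (by positivity)]
      exact mul_le_of_le_one_right h2.le (pow_le_one₀ h1.le (expWeight_lt_one hy).le)
    · filter_upwards [ae_restrict_mem measurableSet_Ioi] with y hy
      simpa using (tendsto_pow_atTop_nhds_zero_of_lt_one (expWeight_pos (le_of_lt hy)).le
        (expWeight_lt_one hy)).const_mul (reciprocalGapDeriv y)
  rw [integral_zero] at h
  refine h.congr' ?_
  filter_upwards [eventually_ne_atTop 0] with n hn using (kappa_eq_integral hn).symm

end

/-! ### Running time of LINEAR on a fixed input. -/

namespace Counted

theorem time_pure {α : Type} (a : α) : (pure a : Counted α).time = 0 := rfl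

theorem time_assign {α : Type} (a : α) : (assign a).time = 1 := rfl

theorem time_bind {α β : Type} (c : Counted α) (f : α → Counted β) :
    (c >>= f).time = c.time + (f c.val).time := by
  change (c.assignments + (f c.val).assignments) + (c.comparisons + (f c.val).comparisons) =
    (c.assignments + c.comparisons) + ((f c.val).assignments + (f c.val).comparisons)
  omega

theorem val_bind {α β : Type} (c : Counted α) (f : α → Counted β) :
    (c >>= f).val = (f c.val).val := rfl

instance : LawfulMonad Counted := LawfulMonad.mk'
  (id_map := fun _ => rfl)
  (pure_bind := fun x f => by
    change (⟨(f x).val, 0 + (f x).assignments, 0 + (f x).comparisons⟩ : Counted _) = f x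
    simp)
  (bind_assoc := fun x f g => by
    change (⟨_, _, _⟩ : Counted _) = ⟨_, _, _⟩
    simp only [Counted.mk.injEq]
    exact ⟨rfl, Nat.add_assoc .., Nat.add_assoc ..⟩)

end Counted

open Counted

/-- The cost of the main loop of LINEAR on the remaining input, from the work vector `v`: every
executed pass through the loop costs one comparison and one assignment. -/
def loopCost {n : ℕ} : List (Fin n) → (Fin n → ℕ) → ℕ
  | [], _ => 0
  | a :: l, v => 2 + if 0 < v a then 0 else loopCost l (Function.update v a (v a + 1))

theorem foldlM_assign_time_val {n : ℕ} (l : List (Fin n)) (v : Fin n → ℕ) :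
    (List.foldlM (fun b a => assign (Function.update b a 0)) v l).time = l.length ∧
    ∀ a, (List.foldlM (fun b a => assign (Function.update b a 0)) v l).val a
      = if a ∈ l then 0 else v a := by
  induction l generalizing v with
  | nil => simp [time_pure]; intro a; rfl
  | cons b l ih =>
    rw [List.foldlM_cons]
    constructor
    · rw [time_bind, (ih _).1, time_assign, List.length_cons, add_comm]
    · intro a
      rw [val_bind, (ih _).2]
      by_cases h : a = b
      · subst h; simp [assign]
      · simp [assign, h]

theorem linear_time (n : ℕ) (v₀ : Fin n → ℕ) (s : Fin n → Fin n) :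
    (linear n v₀ s).time = n + 1 + loopCost (List.ofFn s) (fun _ => 0) := by
  -- The desugared loop carries a possible early return value, the work vector and g; the cost does
  -- not depend on g.
  have key : ∀ (l : List (Fin n)) (v : Fin n → ℕ) (g : Bool),
      (forIn (m := Counted) l ((none : Option Bool), v, g) fun i r => do
        let b ← testPos (r.2.1 (s i))
        if b = true then (fun a => ForInStep.done (some a, r.2.1, a)) <$> assign false
        else (fun a => ForInStep.yield (none, a, r.2.2)) <$>
          assign (Function.update r.2.1 (s i) (r.2.1 (s i) + 1))).time
      = loopCost (l.map s) v := by
    intro l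
    induction l with
    | nil => intro v g; rfl
    | cons i l ih =>
      intro v g
      rw [List.forIn_cons, List.map_cons, loopCost]
      by_cases h : 0 < v (s i)
      · simp [time_bind, testPos, h]
        rfl
      · simp only [testPos, h, time_bind, val_bind, decide_false, Bool.false_eq_true, if_false,
          map_eq_pure_bind]
        change _ + (1 + _) + Counted.time (forIn _ _ _) = _
        rw [← ih _ g]
        rfl
  unfold linear
  simp only [List.forIn_yield_eq_foldlM, bind_pure_comp, id_map']
  obtain ⟨ht, hv⟩ := foldlM_assign_time_val (List.finRange n) v₀
  have hv : (List.foldlM (fun b a => assign (Function.update b a 0)) v₀ (List.finRange n)).val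
      = fun _ => 0 := funext fun a => by simp [hv]
  rw [time_bind, time_bind, time_bind, ht, hv, key, time_assign, ← List.ofFn_eq_map,
    List.length_finRange]
  split <;> rw [time_pure] <;> omega

/-! ### Averaging over all inputs. -/

/-- The induction splits off the first entry and needs an arbitrary `v`, which matters only through
its number j of marked values: a fresh entry, one of n - j, raises j by one; any other entry stops
the loop. -/
theorem sum_loopCost {n : ℕ} (hn : n ≠ 0) (m : ℕ) (v : Fin n → ℕ) :
    ∑ s : Fin m → Fin n, (loopCost (List.ofFn s) v : ℝ) = (n : ℝ) ^ m *
      (2 * ∑ i ∈ Finset.range m, ∏ l ∈ Finset.range i,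
        (1 - (((Finset.univ.filter fun a => 0 < v a).card + l : ℕ) : ℝ) / n)) := by
  have hn' : (n : ℝ) ≠ 0 := by exact_mod_cast hn
  induction m generalizing v with
  | zero => simp [loopCost]
  | succ m ih =>
    set j := (Finset.univ.filter fun a => 0 < v a).card with hj
    have hstep : ∀ a : Fin n, ∑ s : Fin m → Fin n, (loopCost (a :: List.ofFn s) v : ℝ)
        = 2 * (n : ℝ) ^ m + if 0 < v a then 0 else (n : ℝ) ^ m * (2 * ∑ i ∈ Finset.range m,
          ∏ l ∈ Finset.range i, (1 - ((j + (l + 1) : ℕ) : ℝ) / n)) := by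
      intro a
      simp only [loopCost]
      push_cast
      rw [Finset.sum_add_distrib]
      congr 1
      · simp [mul_comm]
      · split_ifs with h
        · simp
        · rw [ih]
          have : (Finset.univ.filter fun b => 0 < Function.update v a (v a + 1) b)
              = insert a (Finset.univ.filter fun b => 0 < v b) := by
            ext b
            by_cases hb : b = a
            · subst hb; simp
            · simp [hb]
          rw [this, Finset.card_insert_of_notMem (by simpa using h), ← hj]
          simp only [add_right_comm, add_assoc, Nat.cast_add, Nat.cast_one]
    have hcard : ((Finset.univ.filter fun a => ¬ 0 < v a).card : ℝ) = n - j := by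
      have := Finset.card_filter_add_card_filter_not (s := (Finset.univ : Finset (Fin n)))
        (fun a => 0 < v a)
      rw [Finset.card_univ, Fintype.card_fin] at this
      rw [eq_sub_iff_add_eq']
      exact_mod_cast this
    rw [← (Fin.consEquiv fun _ => Fin n).sum_comp, Fintype.sum_prod_type]
    have hofFn : ∀ (a : Fin n) (s : Fin m → Fin n),
        List.ofFn (Fin.consEquiv (fun _ => Fin n) (a, s)) = a :: List.ofFn s := fun a s => by
      rw [List.ofFn_succ]; rfl
    simp only [hofFn, hstep]
    rw [Finset.sum_add_distrib, Finset.sum_ite, Finset.sum_const_zero, zero_add, Finset.sum_const, Finset.sum_const,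
      Finset.card_univ, Fintype.card_fin, nsmul_eq_mul, nsmul_eq_mul, hcard,
      Finset.sum_range_succ']
    simp only [Finset.prod_range_succ', Finset.prod_range_zero, ← Finset.sum_mul, add_zero]
    field_simp
    ring

theorem prod_one_sub_eq_distinctProb {n : ℕ} (hn : n ≠ 0) (k : ℕ) :
    ∏ l ∈ Finset.range k, (1 - (l : ℝ) / n) = distinctProb n k := by
  induction k with
  | zero => simp [distinctProb_zero]
  | succ k ih => rw [Finset.prod_range_succ, ih, distinctProb_succ hn, mul_comm]

theorem sum_linear_time {n : ℕ} (hn : n ≠ 0) (v₀ : Fin n → ℕ) :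
    ∑ s : Fin n → Fin n, ((linear n v₀ s).time : ℝ) = (n : ℝ) ^ n *
      (n + 1 + 2 * ∑ k ∈ Finset.range n, distinctProb n k) := by
  simp only [linear_time]
  push_cast
  rw [Finset.sum_add_distrib, sum_loopCost hn]
  simp [prod_one_sub_eq_distinctProb hn]
  ring

theorem integral_comp_of_iIndepFun_uniform {n m : ℕ} {Ω : Type*} [MeasurableSpace Ω]
    (P : Measure Ω) [IsProbabilityMeasure P] (x : Fin m → Ω → Fin n)
    (hm : ∀ i, Measurable (x i)) (hi : iIndepFun x P)
    (hu : ∀ i k, P {ω | x i ω = k} = 1 / (n : ℝ≥0∞)) (f : (Fin m → Fin n) → ℝ) :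
    ∫ ω, f (fun i => x i ω) ∂P = (∑ s, f s) / (n : ℝ) ^ m := by
  have hX : Measurable fun ω i => x i ω := measurable_pi_lambda _ hm
  have := Measure.isProbabilityMeasure_map hX.aemeasurable (μ := P)
  have hs : ∀ s : Fin m → Fin n,
      (P.map fun ω i => x i ω).real {s} = 1 / (n : ℝ) ^ m := by
    intro s
    have h1 : (fun ω i => x i ω) ⁻¹' {s} = ⋂ i ∈ Finset.univ, x i ⁻¹' {s i} := by
      ext ω
      simp [funext_iff]
    rw [measureReal_def, Measure.map_apply hX (measurableSet_singleton s), h1,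
      hi.measure_inter_preimage_eq_mul _ (fun i _ => measurableSet_singleton (s i))]
    have h2 : ∀ i, P (x i ⁻¹' {s i}) = 1 / (n : ℝ≥0∞) := fun i => hu i (s i)
    simp [h2]
  rw [← integral_map hX.aemeasurable (measurable_of_finite f).aestronglyMeasurable,
    integral_fintype (Integrable.of_finite)]
  simp only [hs, smul_eq_mul]
  rw [← Finset.mul_sum]
  ring

theorem theorem10 :
    (∀ (n : ℕ), 1 ≤ n → ∀ (v₀ : Fin n → ℕ)
        (Ω : Type*) [MeasurableSpace Ω] (P : Measure Ω) [IsProbabilityMeasure P]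
        (x : Fin n → Ω → Fin n),
        (∀ i, Measurable (x i)) → iIndepFun x P →
        (∀ i k, P {ω | x i ω = k} = 1 / (n : ℝ≥0∞)) →
        ∫ ω, ((linear n v₀ (fun i => x i ω)).time : ℝ) ∂P
          = n + √(2 * Real.pi * n) + 7 / 3 + 2 * kappa n - 2 * ((n ! : ℝ) / (n : ℝ) ^ n)) ∧
      StrictAntiOn kappa (Set.Ici 1) ∧
      Filter.Tendsto kappa Filter.atTop (𝓝 0) := by

  refine ⟨fun n hn v₀ Ω _ P _ x hm hi hu => ?_, strictAntiOn_kappa, tendsto_kappa⟩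
  have hn0 : n ≠ 0 := by omega
  have hn' : (n : ℝ) ≠ 0 := by exact_mod_cast hn0
  rw [integral_comp_of_iIndepFun_uniform P x hm hi hu fun s => ((linear n v₀ s).time : ℝ),
    sum_linear_time hn0, mul_div_cancel_left₀ _ (pow_ne_zero n hn'),
    kappa_eq_sum_distinctProb hn0, ← distinctProb_self]
  -- The time involves p_0, …, p_{n-1} and κ involves p_1, …, p_n; the difference p_0 - p_n = 1 -
  -- n!/nⁿ supplies the last term of the formula.
  have h1 := Finset.sum_range_succ (distinctProb n) n
  rw [Finset.sum_range_succ', distinctProb_zero] at h1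
  have h2 : √(2 * Real.pi * n) = 2 * √(Real.pi * n / 2) := by
    rw [show 2 * Real.pi * n = 2 ^ 2 * (Real.pi * n / 2) by ring, Real.sqrt_mul (by norm_num),
      Real.sqrt_sq (by norm_num)]
  rw [h2]
  linarith
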